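/- Let $0<T_1<T_2<\dots<T_M=T$ with $M\ge 1$, let $K\subset\mathbb R_+$ be equipped with its Borel $\sigma$-algebra, and let $\nu$ be a probability measure on $K$ with $\nu(\{0\})=0$ and $\int_K y^2\,\nu(dy)<\infty$. On a probability space $(\Omega,\mathcal F,\mathbb P)$ let $\pi_1^{+},\dots,\pi_M^{+},\pi_1^{-},\dots,\pi_M^{-},\pi^{+},\pi^{-}$ be $2(M+1)$ independent Poisson random measures on $\mathbb R_+\times\mathbb R_+\times K$, each with intensity measure $ds\otimes dx\otimes\nu(dy)$. Let $\kappa\ge 0$, $\tilde\mu>0$ and $\tilde\mu_c>0$, and let $g:K\to\mathbb R$ be measurable with $\int_K g^2(y)\,\nu(dy)<\infty$. For $h\in\{+,-\}$, an integer $n\ge 1$ and $t\in[0,T]$, set \[ f^{g,h,(n)}_t=\left(\int_0^t\!\int_{\mathbb R_+}\!\int_K g(y)\,\mathbf 1_{\{x\le n\tilde\mu e^{-\kappa(T_m-s)}\mathbf 1_{s\le T_m}\}}\,\pi^h_m(ds,dx,dy)+\int_0^t\!\int_{\mathbb R_+}\!\int_K g(y)\,\mathbf 1_{\{x\le n\tilde\mu_c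 e^{-\kappa(T_m-s)}\mathbf 1_{s\le T_m}\}}\,\pi^h(ds,dx,dy)\right)_{m=1,\dots,M}. \] Then, for each $h\in\{+,-\}$, these integrals are almost surely well defined (the integrands are almost surely integrable), the supremum below belongs to $L^2(\mathbb P)$ for every $n\ge 1$, and \[ \sup_{t\in[0,T]}\left\|\,n^{-1}f^{g,h,(n)}_t-\left(\int_K g(y)\,\nu(dy)\int_0^t(\tilde\mu+\tilde\mu_c)\,e^{-\kappa(T_m-s)}\,\mathbf 1_{s\le T_m}\,ds\right)_{m=1,\dots,M}\right\|\longrightarrow 0\quad\text{in }L^2(\mathbb P)\text{ as }n\to\infty . \] -/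

import Mathlib

open MeasureTheory Filter Topology
open scoped ENNReal NNReal

/-- A Poisson random measure `N` with intensity measure `μ`, defined on the probability space
`(Ω, P)`: a random measure that is almost surely integer valued and finite on bounded sets, whose
value on a measurable set `A` has the Poisson law with parameter `μ A` (and is almost surely
infinite if `μ A = ∞`), and whose values on finitely many pairwise disjoint measurable sets are
independent. -/
structure IsPoissonRandomMeasure {Ω E : Type*} [MeasurableSpace Ω] [MeasurableSpace E]
    [Bornology E] (N : Ω → Measure E) (μ : Measure E) (P : Measure Ω) : Prop where
  /-- each `ω ↦ N ω A`, with `A` measurable, is a random variable -/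
  measurable : ∀ A : Set E, MeasurableSet A → Measurable fun ω => N ω A
  ae_integer : ∀ᵐ ω ∂P, ∀ A : Set E, MeasurableSet A → ∃ k : ℕ∞, N ω A = (k : ℝ≥0∞)
  ae_finite : ∀ᵐ ω ∂P, ∀ A : Set E, MeasurableSet A → Bornology.IsBounded A → N ω A < ∞
  poisson : ∀ A : Set E, MeasurableSet A → μ A < ∞ →
    ∀ k : ℕ, P {ω | N ω A = (k : ℝ≥0∞)} = ProbabilityTheory.poissonMeasure (μ A).toNNReal {k}
  infinite : ∀ A : Set E, MeasurableSet A → μ A = ∞ → ∀ᵐ ω ∂P, N ω A = ∞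
  indep : ∀ (n : ℕ) (A : Fin n → Set E), (∀ i, MeasurableSet (A i)) →
    (∀ i j, i ≠ j → Disjoint (A i) (A j)) → ProbabilityTheory.iIndepFun (fun i ω => N ω (A i)) P

/-- The two directions of price moves: `plus` for upward moves, `minus` for downward ones. -/
inductive PriceSide where
  | plus : PriceSide
  | minus : PriceSide

/-- The space `ℝ₊ × ℝ₊ × K` of points `(s, x, y)`: time, auxiliary intensity coordinate, mark. -/
abbrev MarkedSpace (K : Set ℝ) : Type := ℝ≥0 × ℝ≥0 × K

/-- Lebesgue measure on `ℝ₊`. -/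
noncomputable def lebesgueNonneg : Measure ℝ≥0 :=
  Measure.comap (fun x : ℝ≥0 => (x : ℝ)) volume

/-- The measure `ds ⊗ dx ⊗ ν(dy)` on `ℝ₊ × ℝ₊ × K`. -/
noncomputable def markedIntensity {K : Set ℝ} (ν : Measure K) : Measure (MarkedSpace K) :=
  lebesgueNonneg.prod (lebesgueNonneg.prod ν)

/-- The intensity `c e^{-κ (τ - s)} 1_{s ≤ τ}` at time `s`, for the maturity `τ`. -/
noncomputable def samuelsonIntensity (c κ τ s : ℝ) : ℝ :=
  c * Real.exp (-κ * (τ - s)) * (if s ≤ τ then 1 else 0)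

/-- The integrand `g(y) 1_{x ≤ c e^{-κ (τ - s)} 1_{s ≤ τ}}`. -/
noncomputable def markedIntegrand {K : Set ℝ} (g : K → ℝ) (c κ τ : ℝ) (p : MarkedSpace K) : ℝ :=
  g p.2.2 * (if (p.2.1 : ℝ) ≤ samuelsonIntensity c κ τ p.1 then 1 else 0)

/-- The strip `(0, t] × ℝ₊ × K`. -/
def timeStrip (K : Set ℝ) (t : ℝ) : Set (MarkedSpace K) :=
  {p | 0 < (p.1 : ℝ) ∧ (p.1 : ℝ) ≤ t}

/-- The vector of `g`-marked integrals up to time `t`, with intensity parameters `c` (specific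
shocks) and `c'` (common shocks). Here `π (some m)` is the measure specific to the `m`-th maturity
and `π none` the measure common to all maturities. -/
noncomputable def markedIntegrals {K : Set ℝ} {M : ℕ} (τ : Fin M → ℝ) (g : K → ℝ) (c c' κ : ℝ)
    (π : Option (Fin M) → Measure (MarkedSpace K)) (t : ℝ) : EuclideanSpace ℝ (Fin M) :=
  WithLp.toLp 2 fun m =>
    (∫ p in timeStrip K t, markedIntegrand g c κ (τ m) p ∂(π (some m))) +
      ∫ p in timeStrip K t, markedIntegrand g c' κ (τ m) p ∂(π none)

/-- The deterministic vector `(∫ g dν · ∫_0^t (c + c') e^{-κ (τ_m - s)} 1_{s ≤ τ_m} ds)_m`. -/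
noncomputable def markedLimit {K : Set ℝ} {M : ℕ} (τ : Fin M → ℝ) (g : K → ℝ) (c c' κ : ℝ)
    (ν : Measure K) (t : ℝ) : EuclideanSpace ℝ (Fin M) :=
  WithLp.toLp 2 fun m =>
    (∫ y, g y ∂ν) * ∫ s in (0 : ℝ)..t, samuelsonIntensity (c + c') κ (τ m) s

/-- The uniform error
`sup_{t ∈ [0, T]} ‖n⁻¹ f_t - (∫ g dν · ∫_0^t (c + c') e^{-κ (τ_m - s)} 1_{s ≤ τ_m} ds)_m‖`,
where `f` is the vector of `g`-marked integrals with intensity parameters `n c` and `n c'`. -/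
noncomputable def uniformError {K : Set ℝ} {M : ℕ} (τ : Fin M → ℝ) (T : ℝ) (g : K → ℝ)
    (c c' κ : ℝ) (ν : Measure K) (π : Option (Fin M) → Measure (MarkedSpace K)) (n : ℕ) : ℝ≥0∞ :=
  ⨆ t ∈ Set.Icc (0 : ℝ) T,
    ‖(n : ℝ)⁻¹ • markedIntegrals τ g (n * c) (n * c') κ π t - markedLimit τ g c c' κ ν t‖ₑ

/-! Fix one maturity, one of the two measures that enter its coordinate, and suppose first that `g ≥
0`. Campbell's formulas, deduced from the Poisson moments and from independence over disjoint sets,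
say that `n⁻¹` times the marked integral up to `t` has mean equal to the limit and variance `n⁻¹ ∫
g² dν ∫₀ᵗ λ`, where `λ` is the intensity with parameter `c`
(`lintegral_enorm_markedDeviation_sq_le`).

Uniformity in `t` comes from monotonicity rather than from a martingale inequality. The marked
integral and its limit are both nondecreasing in `t`, and the limit is Lipschitz, so the deviation
is controlled everywhere by its values on a grid of `k` cells, up to an error of order `1/k`
(`sub_sq_le_grid`). Taking expectations bounds the second moment of the supremum by `2(k+1)V/n +
2(D/k)²`, with `V` and `D` independent of `n` and `k`; the choice `k = ⌊√n⌋` makes this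
`O(n^{-1/2})`.

A signed `g` is split into positive and negative parts, and the vector into its coordinates and its
two summands; Minkowski's inequality reassembles them. Measurability of the suprema is a separate
matter, settled by right-continuity of the paths. -/

/-! ### Moments of the Poisson law -/

/-- The Stein–Chen identity `E[Z φ(Z)] = r E[φ(Z + 1)]` for a Poisson variable `Z` of mean `r`. -/
lemma lintegral_poissonMeasure_mul (r : ℝ≥0) (φ : ℕ → ℝ≥0∞) :
    ∫⁻ k, (k : ℝ≥0∞) * φ k ∂(ProbabilityTheory.poissonMeasure r) =
      r * ∫⁻ k, φ (k + 1) ∂(ProbabilityTheory.poissonMeasure r) := by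
  rw [lintegral_countable', lintegral_countable', ← ENNReal.tsum_mul_left,
    tsum_eq_zero_add' ENNReal.summable]
  simp only [Nat.cast_zero, zero_mul, zero_add]
  refine tsum_congr fun k => ?_
  -- The weights `p_k = e^{-r} r^k / k!` satisfy `(k + 1) p_{k+1} = r p_k`; the identity is this
  -- recursion summed after an index shift.
  have hk : ((k + 1 : ℕ) : ℝ≥0∞) * ProbabilityTheory.poissonMeasure r {k + 1} =
      r * ProbabilityTheory.poissonMeasure r {k} := by
    rw [ProbabilityTheory.poissonMeasure_singleton, ProbabilityTheory.poissonMeasure_singleton,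
      ← ENNReal.ofReal_natCast, ← ENNReal.ofReal_coe_nnreal, ← ENNReal.ofReal_mul (by positivity),
      ← ENNReal.ofReal_mul (by positivity)]
    congr 1
    rw [Nat.factorial_succ]
    push_cast
    field_simp
    ring
  calc ((k + 1 : ℕ) : ℝ≥0∞) * φ (k + 1) * ProbabilityTheory.poissonMeasure r {k + 1}
      = φ (k + 1) * (((k + 1 : ℕ) : ℝ≥0∞) * ProbabilityTheory.poissonMeasure r {k + 1}) := by ring
    _ = _ := by rw [hk]; ring

lemma lintegral_natCast_poissonMeasure (r : ℝ≥0) :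
    ∫⁻ k, (k : ℝ≥0∞) ∂(ProbabilityTheory.poissonMeasure r) = r := by
  simpa using lintegral_poissonMeasure_mul r fun _ => 1

lemma lintegral_natCast_sq_poissonMeasure (r : ℝ≥0) :
    ∫⁻ k, (k : ℝ≥0∞) ^ 2 ∂(ProbabilityTheory.poissonMeasure r) = r + (r : ℝ≥0∞) ^ 2 := by
  have h := lintegral_poissonMeasure_mul r fun k => (k : ℝ≥0∞)
  simp only [← sq, Nat.cast_add, Nat.cast_one] at h
  rw [h, lintegral_add_right _ measurable_const, lintegral_natCast_poissonMeasure]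
  simp
  ring

/-! ### Campbell's formulas for Poisson random measures -/

namespace IsPoissonRandomMeasure

variable {Ω E : Type*} [MeasurableSpace Ω] [MeasurableSpace E] [Bornology E]
  {N : Ω → Measure E} {μ : Measure E} {P : Measure Ω}

lemma measurable_measure (hN : IsPoissonRandomMeasure N μ P) : Measurable N :=
  Measure.measurable_of_measurable_coe _ hN.measurable

lemma measurable_lintegral (hN : IsPoissonRandomMeasure N μ P) {f : E → ℝ≥0∞}
    (hf : Measurable f) : Measurable fun ω => ∫⁻ p, f p ∂(N ω) :=
  (Measure.measurable_lintegral hf).comp hN.measurable_measure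

variable [IsProbabilityMeasure P]

/-- The disjoint events `N A = k` have total mass one, so the expectation splits over these atoms.
Since `φ` is constant on each of them, it needs no measurability. -/
lemma lintegral_comp_apply (hN : IsPoissonRandomMeasure N μ P) {A : Set E}
    (hA : MeasurableSet A) (hμA : μ A < ∞) (φ : ℝ≥0∞ → ℝ≥0∞) :
    ∫⁻ ω, φ (N ω A) ∂P =
      ∫⁻ k, φ (k : ℝ≥0∞) ∂(ProbabilityTheory.poissonMeasure (μ A).toNNReal) := by
  set S : ℕ → Set Ω := fun k => {ω | N ω A = (k : ℝ≥0∞)} with hS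
  have hSm : ∀ k, MeasurableSet (S k) := fun k =>
    hN.measurable A hA (measurableSet_singleton _)
  have hSd : Pairwise (Function.onFun Disjoint S) := by
    intro i j hij
    refine Set.disjoint_left.2 fun ω hi hj => hij ?_
    have : (i : ℝ≥0∞) = j := hi.symm.trans hj
    exact_mod_cast this
  have hS1 : P (⋃ k, S k) = 1 := by
    rw [measure_iUnion hSd hSm, tsum_congr fun k => hN.poisson A hA hμA k]
    simpa using (lintegral_countable' (μ := ProbabilityTheory.poissonMeasure (μ A).toNNReal)
      fun _ => 1).symm
  have hae : ∀ᵐ ω ∂P, ω ∈ ⋃ k, S k :=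
    (mem_ae_iff_prob_eq_one (MeasurableSet.iUnion hSm)).2 hS1
  rw [← setLIntegral_univ, ← setLIntegral_congr (s := ⋃ k, S k) (by
    filter_upwards [hae] with ω hω using propext ⟨fun _ => trivial, fun _ => hω⟩),
    lintegral_iUnion hSm hSd, lintegral_countable']
  refine tsum_congr fun k => ?_
  rw [← hN.poisson A hA hμA k, ← setLIntegral_const]
  exact setLIntegral_congr_fun (hSm k) fun ω hω => by rw [show N ω A = k from hω]

lemma lintegral_apply (hN : IsPoissonRandomMeasure N μ P) {A : Set E} (hA : MeasurableSet A) :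
    ∫⁻ ω, N ω A ∂P = μ A := by
  rcases eq_or_ne (μ A) ∞ with h | h
  · rw [lintegral_congr_ae (hN.infinite A hA h), h]
    simp
  · rw [hN.lintegral_comp_apply hA h.lt_top fun x => x,
      lintegral_natCast_poissonMeasure, ENNReal.coe_toNNReal h]

lemma lintegral_apply_sq (hN : IsPoissonRandomMeasure N μ P) {A : Set E} (hA : MeasurableSet A) :
    ∫⁻ ω, N ω A ^ 2 ∂P = μ A + μ A ^ 2 := by
  rcases eq_or_ne (μ A) ∞ with h | h
  · rw [lintegral_congr_ae (g := fun _ => ∞)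
      (by filter_upwards [hN.infinite A hA h] with ω hω; simp [hω]), h]
    simp
  · rw [hN.lintegral_comp_apply hA h.lt_top fun x => x ^ 2,
      lintegral_natCast_sq_poissonMeasure, ENNReal.coe_toNNReal h]

lemma lintegral_apply_mul_apply (hN : IsPoissonRandomMeasure N μ P) {A B : Set E}
    (hA : MeasurableSet A) (hB : MeasurableSet B) (hAB : Disjoint A B) :
    ∫⁻ ω, N ω A * N ω B ∂P = μ A * μ B := by
  have hind := hN.indep 2 ![A, B] (by simp [Fin.forall_fin_two, hA, hB])
    (by simp [Fin.forall_fin_two, hAB, hAB.symm])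
  have h01 := hind.indepFun (show (0 : Fin 2) ≠ 1 by decide)
  simp only [Matrix.cons_val_zero, Matrix.cons_val_one] at h01
  rw [← hN.lintegral_apply hA, ← hN.lintegral_apply hB]
  exact ProbabilityTheory.lintegral_mul_eq_lintegral_mul_lintegral_of_indepFun
    (hN.measurable A hA) (hN.measurable B hB) h01

/-- Campbell's formula for the first moment. -/
lemma lintegral_lintegral (hN : IsPoissonRandomMeasure N μ P) {f : E → ℝ≥0∞}
    (hf : Measurable f) : ∫⁻ ω, ∫⁻ p, f p ∂(N ω) ∂P = ∫⁻ p, f p ∂μ := by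
  -- The mean measure of `N` is its intensity, so the first moment is an instance of integration
  -- against a mixture.
  have hbind : P.bind N = μ := by
    ext A hA
    rw [Measure.bind_apply hA hN.measurable_measure.aemeasurable, hN.lintegral_apply hA]
  rw [← Measure.lintegral_bind hN.measurable_measure.aemeasurable hf.aemeasurable, hbind]

/-- Expand the square over pairs of fibres. Distinct fibres are disjoint, so their terms factor by
independence; the diagonal terms carry the extra Poisson variance `x² μ(f⁻¹{x})`, which add up to
the integral of `f²`. -/
lemma lintegral_simpleFunc_sq (hN : IsPoissonRandomMeasure N μ P) (f : SimpleFunc E ℝ≥0∞) :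
    ∫⁻ ω, (∫⁻ p, f p ∂(N ω)) ^ 2 ∂P = ∫⁻ p, f p ^ 2 ∂μ + (∫⁻ p, f p ∂μ) ^ 2 := by
  have hm : ∀ x, Measurable fun ω => N ω (f ⁻¹' {x}) := fun x =>
    hN.measurable _ (f.measurableSet_fiber x)
  have hsq : ∫⁻ p, f p ^ 2 ∂μ = ∑ x ∈ f.range, x ^ 2 * μ (f ⁻¹' {x}) := by
    have := (f.map (· ^ 2)).lintegral_eq_lintegral μ
    rw [SimpleFunc.map_lintegral] at this
    simpa using this
  simp_rw [hsq, SimpleFunc.lintegral_eq_lintegral, SimpleFunc.lintegral, sq (∑ x ∈ f.range, _),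
    Finset.sum_mul_sum]
  have hxym : ∀ x y, Measurable fun ω => x * N ω (f ⁻¹' {x}) * (y * N ω (f ⁻¹' {y})) :=
    fun x y => ((hm x).const_mul _).mul ((hm y).const_mul _)
  rw [lintegral_finsetSum _ fun x _ => Finset.measurable_sum _ fun y _ => hxym x y,
    ← Finset.sum_add_distrib]
  refine Finset.sum_congr rfl fun x hx => ?_
  rw [lintegral_finsetSum _ fun y _ => hxym x y]
  have hxy : ∀ y ∈ f.range, ∫⁻ ω, x * N ω (f ⁻¹' {x}) * (y * N ω (f ⁻¹' {y})) ∂P =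
      x * μ (f ⁻¹' {x}) * (y * μ (f ⁻¹' {y})) +
        if y = x then x ^ 2 * μ (f ⁻¹' {x}) else 0 := by
    intro y _
    simp_rw [mul_mul_mul_comm]
    have hmul : Measurable fun ω => N ω (f ⁻¹' {x}) * N ω (f ⁻¹' {y}) := (hm x).mul (hm y)
    rw [lintegral_const_mul _ hmul]
    split_ifs with h
    · subst h
      simp_rw [← sq]
      rw [hN.lintegral_apply_sq (f.measurableSet_fiber y)]
      ring
    · rw [hN.lintegral_apply_mul_apply (f.measurableSet_fiber x) (f.measurableSet_fiber y)
        (Disjoint.preimage _ (Set.disjoint_singleton.2 fun h' => h h'.symm)), add_zero]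
  rw [Finset.sum_congr rfl hxy, Finset.sum_add_distrib, Finset.sum_ite_eq' , if_pos hx, add_comm]

/-- Campbell's formula for the second moment. -/
lemma lintegral_lintegral_sq (hN : IsPoissonRandomMeasure N μ P) {f : E → ℝ≥0∞}
    (hf : Measurable f) :
    ∫⁻ ω, (∫⁻ p, f p ∂(N ω)) ^ 2 ∂P = ∫⁻ p, f p ^ 2 ∂μ + (∫⁻ p, f p ∂μ) ^ 2 := by
  set s : ℕ → SimpleFunc E ℝ≥0∞ := SimpleFunc.eapprox f with hs
  have hmono : ∀ p, Monotone fun k => s k p := fun p i j hij => SimpleFunc.monotone_eapprox f hij p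
  have hlim : ∀ p, Tendsto (fun k => s k p) atTop (𝓝 (f p)) := fun p => by
    rw [← SimpleFunc.iSup_eapprox_apply hf p]
    exact tendsto_atTop_iSup (hmono p)
  -- Stated for every measure, because it is needed both for `μ` and for each realisation `N ω`.
  have h1 : ∀ ρ : Measure E, Tendsto (fun k => ∫⁻ p, s k p ∂ρ) atTop (𝓝 (∫⁻ p, f p ∂ρ)) :=
    fun ρ => lintegral_tendsto_of_tendsto_of_monotone (fun k => (s k).measurable.aemeasurable)
      (ae_of_all _ hmono) (ae_of_all _ hlim)
  have h2 : Tendsto (fun k => ∫⁻ p, s k p ^ 2 ∂μ) atTop (𝓝 (∫⁻ p, f p ^ 2 ∂μ)) :=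
    lintegral_tendsto_of_tendsto_of_monotone
      (fun k => ((s k).measurable.pow_const 2).aemeasurable)
      (ae_of_all _ fun p i j hij => pow_le_pow_left' (hmono p hij) 2)
      (ae_of_all _ fun p => ENNReal.Tendsto.pow (hlim p))
  have h3 : Tendsto (fun k => ∫⁻ ω, (∫⁻ p, s k p ∂(N ω)) ^ 2 ∂P) atTop
      (𝓝 (∫⁻ ω, (∫⁻ p, f p ∂(N ω)) ^ 2 ∂P)) :=
    lintegral_tendsto_of_tendsto_of_monotone
      (fun k => ((hN.measurable_lintegral (s k).measurable).pow_const 2).aemeasurable)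
      (ae_of_all _ fun ω i j hij =>
        pow_le_pow_left' (lintegral_mono fun p => hmono p hij) 2)
      (ae_of_all _ fun ω => ENNReal.Tendsto.pow (h1 (N ω)))
  refine tendsto_nhds_unique h3 ?_
  simp_rw [hN.lintegral_simpleFunc_sq]
  exact h2.add (ENNReal.Tendsto.pow (h1 μ))

lemma ae_integrable (hN : IsPoissonRandomMeasure N μ P) {f : E → ℝ} (hf : Measurable f)
    (hfi : Integrable f μ) : ∀ᵐ ω ∂P, Integrable f (N ω) := by
  have h : ∫⁻ ω, ∫⁻ p, ‖f p‖ₑ ∂(N ω) ∂P ≠ ∞ := by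
    rw [hN.lintegral_lintegral hf.enorm]
    exact hfi.2.ne
  filter_upwards [ae_lt_top (hN.measurable_lintegral hf.enorm) h] with ω hω
  exact ⟨hf.aestronglyMeasurable, hω⟩

/-- The integrals of the positive and negative parts are measurable in `ω` as lower integrals, and
almost surely their difference is the Bochner integral. -/
lemma aemeasurable_integral (hN : IsPoissonRandomMeasure N μ P) {f : E → ℝ} (hf : Measurable f)
    (hfi : Integrable f μ) : AEMeasurable (fun ω => ∫ p, f p ∂(N ω)) P := by
  refine AEMeasurable.congr (f := fun ω => (∫⁻ p, ENNReal.ofReal (f p) ∂(N ω)).toReal -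
    (∫⁻ p, ENNReal.ofReal (-f p) ∂(N ω)).toReal) ?_ ?_
  · exact ((hN.measurable_lintegral hf.ennreal_ofReal).ennreal_toReal.sub
      (hN.measurable_lintegral hf.neg.ennreal_ofReal).ennreal_toReal).aemeasurable
  · filter_upwards [hN.ae_integrable hf hfi] with ω hω
    rw [integral_eq_lintegral_pos_part_sub_lintegral_neg_part hω]

/-- The variance of the integral of a nonnegative function against a Poisson random measure. -/
lemma lintegral_enorm_integral_sub_sq (hN : IsPoissonRandomMeasure N μ P) {f : E → ℝ}
    (hf : Measurable f) (hf0 : 0 ≤ f) (hfi : Integrable f μ) :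
    ∫⁻ ω, ‖∫ p, f p ∂(N ω) - ∫ p, f p ∂μ‖ₑ ^ 2 ∂P = ∫⁻ p, ENNReal.ofReal (f p) ^ 2 ∂μ := by
  set F : Ω → ℝ≥0∞ := fun ω => ∫⁻ p, ENNReal.ofReal (f p) ∂(N ω) with hF
  set a : ℝ≥0∞ := ∫⁻ p, ENNReal.ofReal (f p) ∂μ with ha
  have hFm : Measurable F := hN.measurable_lintegral hf.ennreal_ofReal
  have hF1 : ∫⁻ ω, F ω ∂P = a := hN.lintegral_lintegral hf.ennreal_ofReal
  have hF2 : ∫⁻ ω, F ω ^ 2 ∂P = ∫⁻ p, ENNReal.ofReal (f p) ^ 2 ∂μ + a ^ 2 :=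
    hN.lintegral_lintegral_sq hf.ennreal_ofReal
  have ha_top : a ≠ ∞ := by
    have := hfi.2
    rw [hasFiniteIntegral_iff_ofReal (ae_of_all _ hf0)] at this
    exact this.ne
  have hF_top : ∀ᵐ ω ∂P, F ω < ∞ := ae_lt_top hFm (by rw [hF1]; exact ha_top)
  -- The expanded square is written with the cross term on the left, because subtraction in `ℝ≥0∞`
  -- truncates; after integration the finite quantity `2 * a * a` is cancelled.
  have hpt : ∀ᵐ ω ∂P, ‖∫ p, f p ∂(N ω) - ∫ p, f p ∂μ‖ₑ ^ 2 + 2 * a * F ω = F ω ^ 2 + a ^ 2 := by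
    filter_upwards [hF_top] with ω hω
    rw [integral_eq_lintegral_of_nonneg_ae (ae_of_all _ hf0) hf.aestronglyMeasurable,
      integral_eq_lintegral_of_nonneg_ae (ae_of_all _ hf0) hf.aestronglyMeasurable]
    change ‖(F ω).toReal - a.toReal‖ₑ ^ 2 + _ = _
    lift F ω to ℝ≥0 using hω.ne with x
    lift a to ℝ≥0 using ha_top with y
    rw [← ofReal_norm, ← ENNReal.ofReal_pow (norm_nonneg _), Real.norm_eq_abs, sq_abs]
    have h2 : (2 : ℝ≥0∞) * y * x = ENNReal.ofReal (2 * y * x) := by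
      rw [ENNReal.ofReal_mul (by positivity), ENNReal.ofReal_mul zero_le_two]
      simp
    have hsq : ∀ z : ℝ≥0, (z : ℝ≥0∞) ^ 2 = ENNReal.ofReal ((z : ℝ) ^ 2) := fun z => by
      rw [ENNReal.ofReal_pow z.coe_nonneg, ENNReal.ofReal_coe_nnreal]
    rw [h2, hsq, hsq, ← ENNReal.ofReal_add (sq_nonneg _) (by positivity),
      ← ENNReal.ofReal_add (sq_nonneg _) (sq_nonneg _)]
    simp only [ENNReal.coe_toReal]
    congr 1
    ring
  have hint := lintegral_congr_ae hpt
  rw [lintegral_add_right _ (hFm.const_mul _), lintegral_const_mul _ hFm, hF1,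
    lintegral_add_right _ measurable_const, hF2] at hint
  simp only [lintegral_const, measure_univ, mul_one] at hint
  have h2 : 2 * a * a ≠ ∞ := by finiteness
  rw [← ENNReal.add_left_inj h2, hint]
  ring

end IsPoissonRandomMeasure

/-! ### Lebesgue measure on the half-line and the exponential intensity -/

lemma measurableEmbedding_nnreal_coe : MeasurableEmbedding ((↑) : ℝ≥0 → ℝ) :=
  MeasurableEmbedding.subtype_coe measurableSet_Ici

instance sigmaFinite_lebesgueNonneg : SigmaFinite lebesgueNonneg := by
  refine SigmaFinite.of_map _ measurableEmbedding_nnreal_coe.measurable.aemeasurable ?_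
  rw [lebesgueNonneg, measurableEmbedding_nnreal_coe.map_comap]
  infer_instance

lemma lintegral_lebesgueNonneg (f : ℝ → ℝ≥0∞) :
    ∫⁻ s, f s ∂lebesgueNonneg = ∫⁻ s in Set.Ici 0, f s := by
  rw [lebesgueNonneg, ← measurableEmbedding_nnreal_coe.lintegral_map,
    measurableEmbedding_nnreal_coe.map_comap]
  congr 2
  ext x
  simp

lemma lebesgueNonneg_setOf_le (a : ℝ) : lebesgueNonneg {x | (x : ℝ) ≤ a} = ENNReal.ofReal a := by
  rw [lebesgueNonneg, measurableEmbedding_nnreal_coe.comap_apply]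
  have : ((↑) : ℝ≥0 → ℝ) '' {x | (x : ℝ) ≤ a} = Set.Icc 0 a := by
    ext x
    simp only [Set.mem_image, Set.mem_ofPred_eq, Set.mem_Icc]
    exact ⟨by rintro ⟨y, hy, rfl⟩; exact ⟨y.2, hy⟩, fun hx => ⟨⟨x, hx.1⟩, hx.2, rfl⟩⟩
  rw [this, Real.volume_Icc, sub_zero]

lemma measurable_samuelsonIntensity (c κ τ : ℝ) : Measurable (samuelsonIntensity c κ τ) := by
  unfold samuelsonIntensity
  refine Measurable.mul (by fun_prop) ?_
  exact Measurable.ite measurableSet_Iic measurable_const measurable_const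

lemma samuelsonIntensity_mul (a c κ τ s : ℝ) :
    samuelsonIntensity (a * c) κ τ s = a * samuelsonIntensity c κ τ s := by
  simp only [samuelsonIntensity, mul_assoc]

lemma samuelsonIntensity_add (c c' κ τ s : ℝ) :
    samuelsonIntensity (c + c') κ τ s =
      samuelsonIntensity c κ τ s + samuelsonIntensity c' κ τ s := by
  simp only [samuelsonIntensity, add_mul]

lemma samuelsonIntensity_nonneg {c : ℝ} (hc : 0 ≤ c) (κ τ s : ℝ) :
    0 ≤ samuelsonIntensity c κ τ s := by
  unfold samuelsonIntensity
  split_ifs <;> positivity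

lemma samuelsonIntensity_le {c κ : ℝ} (hc : 0 ≤ c) (hκ : 0 ≤ κ) (τ s : ℝ) :
    samuelsonIntensity c κ τ s ≤ c := by
  unfold samuelsonIntensity
  split_ifs with h
  · rw [mul_one]
    refine mul_le_of_le_one_right hc (Real.exp_le_one_iff.2 ?_)
    nlinarith [sub_nonneg.2 h]
  · simpa using hc

lemma intervalIntegrable_samuelsonIntensity {c κ : ℝ} (hc : 0 ≤ c) (hκ : 0 ≤ κ) (τ a b : ℝ) :
    IntervalIntegrable (samuelsonIntensity c κ τ) volume a b := by
  refine (intervalIntegrable_const (c := c)).mono_fun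
    (measurable_samuelsonIntensity c κ τ).aestronglyMeasurable (ae_of_all _ fun s => ?_)
  beta_reduce
  rw [Real.norm_of_nonneg (samuelsonIntensity_nonneg hc κ τ s), Real.norm_of_nonneg hc]
  exact samuelsonIntensity_le hc hκ τ s

lemma integral_samuelsonIntensity_nonneg {c : ℝ} (hc : 0 ≤ c) (κ τ : ℝ) {a b : ℝ} (hab : a ≤ b) :
    0 ≤ ∫ s in a..b, samuelsonIntensity c κ τ s :=
  intervalIntegral.integral_nonneg hab fun s _ => samuelsonIntensity_nonneg hc κ τ s

lemma integral_samuelsonIntensity_le {c κ : ℝ} (hc : 0 ≤ c) (hκ : 0 ≤ κ) (τ : ℝ) {a b : ℝ}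
    (hab : a ≤ b) : ∫ s in a..b, samuelsonIntensity c κ τ s ≤ c * (b - a) := by
  calc ∫ s in a..b, samuelsonIntensity c κ τ s ≤ ∫ _ in a..b, c :=
        intervalIntegral.integral_mono_on hab (intervalIntegrable_samuelsonIntensity hc hκ τ a b)
          intervalIntegrable_const fun s _ => samuelsonIntensity_le hc hκ τ s
    _ = c * (b - a) := by rw [intervalIntegral.integral_const, smul_eq_mul, mul_comm]

lemma lintegral_samuelsonIntensity {c κ : ℝ} (hc : 0 ≤ c) (hκ : 0 ≤ κ) (τ : ℝ) {t : ℝ}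
    (ht : 0 ≤ t) : ∫⁻ s in Set.Ioc 0 t, ENNReal.ofReal (samuelsonIntensity c κ τ s) =
      ENNReal.ofReal (∫ s in (0 : ℝ)..t, samuelsonIntensity c κ τ s) := by
  rw [intervalIntegral.integral_of_le ht, ofReal_integral_eq_lintegral_ofReal
    ((intervalIntegrable_iff_integrableOn_Ioc_of_le ht).1
      (intervalIntegrable_samuelsonIntensity hc hκ τ 0 t))
    (ae_of_all _ fun s => samuelsonIntensity_nonneg hc κ τ s)]

/-! ### Integrals of the marked integrand against the intensity measure -/

section Marked

variable {K : Set ℝ}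

lemma measurableSet_timeStrip (t : ℝ) : MeasurableSet (timeStrip K t) := by
  have h : Measurable fun p : MarkedSpace K => (p.1 : ℝ) := by fun_prop
  exact (measurableSet_lt measurable_const h).inter (measurableSet_le h measurable_const)

lemma timeStrip_mono {s t : ℝ} (hst : s ≤ t) : timeStrip K s ⊆ timeStrip K t :=
  fun _ hp => ⟨hp.1, hp.2.trans hst⟩

lemma measurableSet_le_intensity {l : ℝ → ℝ} (hl : Measurable l) :
    MeasurableSet {p : MarkedSpace K | (p.2.1 : ℝ) ≤ l p.1} :=
  measurableSet_le (by fun_prop) (by fun_prop)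

lemma measurable_markedIntegrand {g : K → ℝ} (hg : Measurable g) (c κ τ : ℝ) :
    Measurable (markedIntegrand g c κ τ) :=
  (hg.comp (by fun_prop)).mul (Measurable.ite
    (measurableSet_le_intensity (measurable_samuelsonIntensity c κ τ)) measurable_const
    measurable_const)

lemma markedIntegrand_nonneg {g : K → ℝ} (hg : 0 ≤ g) (c κ τ : ℝ) :
    0 ≤ markedIntegrand g c κ τ := by
  intro p
  unfold markedIntegrand
  have := hg p.2.2
  simp only [Pi.zero_apply] at this ⊢
  split_ifs <;> simp [this]

/-- Tonelli: at fixed `s` the section `{x ≤ l s}` of the half-line has length `ENNReal.ofReal (l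
s)`, which is right for negative `l s` too, and the mark integrates out as a factor. -/
lemma lintegral_timeStrip (ν : Measure K) [SFinite ν] {γ : K → ℝ≥0∞} (hγ : Measurable γ)
    {l : ℝ → ℝ} (hl : Measurable l) (t : ℝ) :
    ∫⁻ p in timeStrip K t, γ p.2.2 * (if (p.2.1 : ℝ) ≤ l p.1 then 1 else 0) ∂(markedIntensity ν) =
      (∫⁻ y, γ y ∂ν) * ∫⁻ s in Set.Ioc 0 t, ENNReal.ofReal (l s) := by
  set A : Set ℝ≥0 := {s | 0 < (s : ℝ) ∧ (s : ℝ) ≤ t} with hA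
  have hAm : MeasurableSet A :=
    (measurableSet_lt measurable_const measurable_subtype_coe).inter
      (measurableSet_le measurable_subtype_coe measurable_const)
  have hstrip : timeStrip K t = A ×ˢ Set.univ := by
    ext p
    simp [timeStrip, hA]
  have hm : Measurable fun p : MarkedSpace K =>
      γ p.2.2 * (if (p.2.1 : ℝ) ≤ l p.1 then 1 else 0) :=
    (hγ.comp (by fun_prop)).mul (Measurable.ite (measurableSet_le_intensity hl) measurable_const
      measurable_const)
  have hinner : ∀ s : ℝ≥0, ∫⁻ q : ℝ≥0 × K, γ q.2 * (if (q.1 : ℝ) ≤ l s then 1 else 0)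
      ∂(lebesgueNonneg.prod ν) = (∫⁻ y, γ y ∂ν) * ENNReal.ofReal (l s) := by
    intro s
    have hs : MeasurableSet {x : ℝ≥0 | (x : ℝ) ≤ l s} :=
      measurableSet_le measurable_subtype_coe measurable_const
    simp_rw [mul_comm (γ _)]
    rw [lintegral_prod_mul (f := fun x : ℝ≥0 => if (x : ℝ) ≤ l s then (1 : ℝ≥0∞) else 0)
      (Measurable.ite hs measurable_const measurable_const).aemeasurable hγ.aemeasurable, mul_comm]
    congr 1
    rw [← lebesgueNonneg_setOf_le, ← lintegral_indicator_one hs]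
    rfl
  rw [hstrip, markedIntensity, setLIntegral_prod _ hm.aemeasurable]
  simp only [setLIntegral_univ, hinner]
  rw [lintegral_const_mul _ (by fun_prop), ← lintegral_indicator hAm]
  congr 1
  have : ∀ s : ℝ≥0, A.indicator (fun s : ℝ≥0 => ENNReal.ofReal (l s)) s =
      (Set.Ioc 0 t).indicator (fun s : ℝ => ENNReal.ofReal (l s)) s := fun s => by
    simp only [Set.indicator, hA, Set.mem_ofPred_eq, Set.mem_Ioc]
  simp_rw [this]
  rw [lintegral_lebesgueNonneg, setLIntegral_indicator measurableSet_Ioc]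
  congr 2
  exact Set.inter_eq_left.2 fun x hx => hx.1.le

variable (ν : Measure K) [IsFiniteMeasure ν] {c κ : ℝ}

lemma lintegral_enorm_markedIntegrand {g : K → ℝ} (hg : Measurable g) (hc : 0 ≤ c) (hκ : 0 ≤ κ)
    (τ : ℝ) {t : ℝ} (ht : 0 ≤ t) :
    ∫⁻ p in timeStrip K t, ‖markedIntegrand g c κ τ p‖ₑ ∂(markedIntensity ν) =
      (∫⁻ y, ‖g y‖ₑ ∂ν) * ENNReal.ofReal (∫ s in (0 : ℝ)..t, samuelsonIntensity c κ τ s) := by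
  rw [← lintegral_samuelsonIntensity hc hκ τ ht,
    ← lintegral_timeStrip ν hg.enorm (measurable_samuelsonIntensity c κ τ)]
  refine lintegral_congr fun p => ?_
  unfold markedIntegrand
  split_ifs <;> simp

lemma integrableOn_markedIntegrand {g : K → ℝ} (hg : Measurable g) (hgi : Integrable g ν)
    (hc : 0 ≤ c) (hκ : 0 ≤ κ) (τ : ℝ) {t : ℝ} (ht : 0 ≤ t) :
    IntegrableOn (markedIntegrand g c κ τ) (timeStrip K t) (markedIntensity ν) := by
  refine ⟨(measurable_markedIntegrand hg c κ τ).aestronglyMeasurable, ?_⟩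
  rw [hasFiniteIntegral_iff_enorm, lintegral_enorm_markedIntegrand ν hg hc hκ τ ht]
  exact ENNReal.mul_lt_top hgi.2 ENNReal.ofReal_lt_top

lemma integral_markedIntegrand {g : K → ℝ} (hg : Measurable g) (hg0 : 0 ≤ g) (hc : 0 ≤ c)
    (hκ : 0 ≤ κ) (τ : ℝ) {t : ℝ} (ht : 0 ≤ t) :
    ∫ p in timeStrip K t, markedIntegrand g c κ τ p ∂(markedIntensity ν) =
      (∫ y, g y ∂ν) * ∫ s in (0 : ℝ)..t, samuelsonIntensity c κ τ s := by
  have h := lintegral_enorm_markedIntegrand ν hg hc hκ τ ht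
  have h0 := markedIntegrand_nonneg hg0 c κ τ
  simp_rw [Real.enorm_of_nonneg (h0 _), Real.enorm_of_nonneg (hg0 _)] at h
  rw [integral_eq_lintegral_of_nonneg_ae (ae_of_all _ h0)
    (measurable_markedIntegrand hg c κ τ).aestronglyMeasurable, h, ENNReal.toReal_mul,
    ENNReal.toReal_ofReal (integral_samuelsonIntensity_nonneg hc κ τ ht),
    integral_eq_lintegral_of_nonneg_ae (ae_of_all _ hg0) hg.aestronglyMeasurable]

/-- An indicator equals its square, so squaring the integrand only replaces `g` by `g²`; the
intensity enters to the first power. -/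
lemma lintegral_markedIntegrand_sq {g : K → ℝ} (hg : Measurable g)
    (hg2 : Integrable (fun y => g y ^ 2) ν) (hg0 : 0 ≤ g) (hc : 0 ≤ c)
    (hκ : 0 ≤ κ) (τ : ℝ) {t : ℝ} (ht : 0 ≤ t) :
    ∫⁻ p in timeStrip K t, ENNReal.ofReal (markedIntegrand g c κ τ p) ^ 2 ∂(markedIntensity ν) =
      ENNReal.ofReal ((∫ y, g y ^ 2 ∂ν) * ∫ s in (0 : ℝ)..t, samuelsonIntensity c κ τ s) := by
  rw [ENNReal.ofReal_mul (integral_nonneg fun y => sq_nonneg _),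
    ← lintegral_samuelsonIntensity hc hκ τ ht, ofReal_integral_eq_lintegral_ofReal hg2
      (ae_of_all _ fun y => sq_nonneg _),
    ← lintegral_timeStrip ν (hg.pow_const 2).ennreal_ofReal (measurable_samuelsonIntensity c κ τ)]
  refine lintegral_congr fun p => ?_
  unfold markedIntegrand
  split_ifs
  · simp [ENNReal.ofReal_pow (hg0 _)]
  · simp

end Marked

/-! ### Right-continuous paths and comparison on a grid -/

/-- By right-continuity each value at `t < T` is a limit of values at rationals in `(t, T)`. The
endpoint `T` has no such approximation and is added by hand. The countable supremum is what makes
`markedSup` and `uniformError` measurable in `ω`. -/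
lemma iSup_Icc_eq_iSup_rat {f : ℝ → ℝ≥0∞} {T : ℝ}
    (hf : ∀ t ∈ Set.Ico 0 T, ContinuousWithinAt f (Set.Ioi t) t) :
    ⨆ t ∈ Set.Icc 0 T, f t =
      ⨆ t ∈ (Set.range ((↑) : ℚ → ℝ) ∪ {T}) ∩ Set.Icc 0 T, f t := by
  refine le_antisymm (iSup₂_le fun t ht => ?_)
    (iSup₂_le fun t ht => le_iSup₂_of_le t ht.2 le_rfl)
  rcases eq_or_lt_of_le ht.2 with rfl | htT
  · exact le_iSup₂_of_le t ⟨Or.inr rfl, ht⟩ le_rfl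
  · refine le_of_tendsto_of_frequently (hf t ⟨ht.1, htT⟩) ?_
    rw [frequently_iff]
    intro U hU
    obtain ⟨u, hu, hU⟩ := (mem_nhdsGT_iff_exists_Ioo_subset' htT).1 hU
    obtain ⟨q, hq1, hq2⟩ := exists_rat_btwn (lt_min (Set.mem_Ioi.1 hu) htT)
    refine ⟨q, hU ⟨hq1, hq2.trans_le (min_le_left _ _)⟩, le_iSup₂_of_le (q : ℝ)
      ⟨Or.inl ⟨q, rfl⟩, ht.1.trans hq1.le, (hq2.trans_le (min_le_right _ _)).le⟩ le_rfl⟩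

/-- Dominated convergence: the strips are closed on the right, so as `s ↓ t` the indicator at any
given point is eventually equal to its value for `t`. -/
lemma continuousWithinAt_setIntegral_timeStrip {K : Set ℝ} {ρ : Measure (MarkedSpace K)}
    {f : MarkedSpace K → ℝ} {T : ℝ} (hf : IntegrableOn f (timeStrip K T) ρ) {t : ℝ} (ht : t < T) :
    ContinuousWithinAt (fun s => ∫ p in timeStrip K s, f p ∂ρ) (Set.Ioi t) t := by
  simp_rw [ContinuousWithinAt, ← integral_indicator (measurableSet_timeStrip _)]
  have hT : ∀ᶠ s in 𝓝[>] t, s < T := eventually_nhdsWithin_of_eventually_nhds (eventually_lt_nhds ht)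
  refine tendsto_integral_filter_of_dominated_convergence
    (fun p => ‖(timeStrip K T).indicator f p‖) ?_ ?_
    (hf.integrable_indicator (measurableSet_timeStrip T)).norm (ae_of_all _ fun p => ?_)
  · filter_upwards [hT] with s hs
    exact ((hf.mono_set (timeStrip_mono hs.le)).integrable_indicator
      (measurableSet_timeStrip s)).aestronglyMeasurable
  · filter_upwards [hT] with s hs
    refine ae_of_all _ fun p => ?_
    exact norm_indicator_le_of_subset (timeStrip_mono hs.le) f p
  · refine tendsto_const_nhds.congr' ?_
    rcases le_or_gt (p.1 : ℝ) t with h | h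
    · filter_upwards [self_mem_nhdsWithin] with s hs
      have hs' : t < s := hs
      simp [Set.indicator, timeStrip, h, h.trans hs'.le]
    · filter_upwards [eventually_nhdsWithin_of_eventually_nhds (eventually_lt_nhds h)] with s hs
      simp [Set.indicator, timeStrip, h.not_ge, hs.not_ge]

lemma exists_grid_cell {T t : ℝ} (hT : 0 < T) (ht : t ∈ Set.Icc 0 T) {k : ℕ} (hk : 0 < k) :
    ∃ i < k, i * T / k ≤ t ∧ t ≤ (i + 1 : ℕ) * T / k := by
  have hk' : (0 : ℝ) < k := by exact_mod_cast hk
  rcases ht.1.eq_or_lt with h0 | h0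
  · exact ⟨0, hk, by simp [ht.1], by rw [← h0]; positivity⟩
  · have hpos : 0 < ⌈t * k / T⌉₊ := Nat.ceil_pos.2 (by positivity)
    obtain ⟨i, hi⟩ := Nat.exists_eq_succ_of_ne_zero hpos.ne'
    have h1 : t * k / T ≤ (i + 1 : ℕ) := by
      rw [← Nat.succ_eq_add_one, ← hi]
      exact Nat.le_ceil _
    have h2 : (i : ℝ) < t * k / T := Nat.lt_ceil.1 (by omega)
    have h3 : ⌈t * k / T⌉₊ ≤ k := by
      refine Nat.ceil_le.2 ((div_le_iff₀ hT).2 ?_)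
      rw [mul_comm]
      exact mul_le_mul_of_nonneg_left ht.2 hk'.le
    refine ⟨i, by omega, ?_, ?_⟩
    · rw [div_le_iff₀ hk']
      exact ((lt_div_iff₀ hT).1 h2).le
    · rw [le_div_iff₀ hk']
      exact (div_le_iff₀ hT).1 h1

/-- A nondecreasing function stays close to a nondecreasing Lipschitz function on an interval if
it is close to it on a fine grid. -/
lemma sub_sq_le_grid {X x : ℝ → ℝ} {T L : ℝ} (hT : 0 < T) (hX : MonotoneOn X (Set.Icc 0 T))
    (hx : MonotoneOn x (Set.Icc 0 T))
    (hL : ∀ s ∈ Set.Icc 0 T, ∀ t ∈ Set.Icc 0 T, s ≤ t → x t - x s ≤ L * (t - s)) {k : ℕ}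
    (hk : 0 < k) {t : ℝ} (ht : t ∈ Set.Icc 0 T) :
    (X t - x t) ^ 2 ≤
      2 * ∑ i ∈ Finset.range (k + 1), (X (i * T / k) - x (i * T / k)) ^ 2 + 2 * (L * T / k) ^ 2 := by
  have hk' : (0 : ℝ) < k := by exact_mod_cast hk
  obtain ⟨i, hik, hi1, hi2⟩ := exists_grid_cell hT ht hk
  have hmem : ∀ j : ℕ, j ≤ k → (j * T / k : ℝ) ∈ Set.Icc 0 T := fun j hj =>
    ⟨by positivity, by
      rw [div_le_iff₀ hk', mul_comm]
      exact mul_le_mul_of_nonneg_left (by exact_mod_cast hj) hT.le⟩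
  have hsum : ∀ j : ℕ, j ≤ k → (X (j * T / k) - x (j * T / k)) ^ 2 ≤
      ∑ i ∈ Finset.range (k + 1), (X (i * T / k) - x (i * T / k)) ^ 2 := fun j hj =>
    Finset.single_le_sum (f := fun i : ℕ => (X (i * T / k) - x (i * T / k)) ^ 2)
      (fun _ _ => sq_nonneg _) (Finset.mem_range.2 (by omega))
  have ha := hmem i hik.le
  have hb := hmem (i + 1) hik
  have hinc := hL _ ha _ hb (hi1.trans hi2)
  have hstep : L * ((i + 1 : ℕ) * T / k - i * T / k) = L * T / k := by
    push_cast
    ring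
  rw [hstep] at hinc
  have h1 := hX ha ht hi1
  have h2 := hX ht hb hi2
  have h3 := hx ha ht hi1
  have h4 := hx ht hb hi2
  have hsa := hsum i hik.le
  have hsb := hsum (i + 1) hik
  generalize (∑ i ∈ Finset.range (k + 1), (X (i * T / k) - x (i * T / k)) ^ 2) = S at *
  generalize L * T / k = δ at *
  generalize X (i * T / k) = Xa at *
  generalize x (i * T / k) = xa at *
  generalize X ((i + 1 : ℕ) * T / k) = Xb at *
  generalize x ((i + 1 : ℕ) * T / k) = xb at *
  -- An excess of `X` over `x` is compared at the right end of the cell, a deficit at the left end.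
  -- In both cases the price is the increment `δ`, and `(a + b)² ≤ 2a² + 2b²` finishes.
  rcases le_total 0 (X t - x t) with h | h
  · have h5 : X t - x t ≤ (Xb - xb) + δ := by linarith
    have h6 : (X t - x t) ^ 2 ≤ ((Xb - xb) + δ) ^ 2 := pow_le_pow_left₀ h h5 2
    nlinarith [sq_nonneg ((Xb - xb) - δ)]
  · have h5 : -(X t - x t) ≤ δ - (Xa - xa) := by linarith
    have h6 : (-(X t - x t)) ^ 2 ≤ (δ - (Xa - xa)) ^ 2 :=
      pow_le_pow_left₀ (by linarith) h5 2
    nlinarith [sq_nonneg ((Xa - xa) + δ)]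

/-! ### Sequences tending to zero in `L²` -/

/-- A sequence of nonnegative random variables that are square integrable from the first one on
and tend to `0` in `L²`. -/
def IsL2Null {Ω : Type*} [MeasurableSpace Ω] (F : ℕ → Ω → ℝ≥0∞) (P : Measure Ω) : Prop :=
  (∀ n, 1 ≤ n → MemLp (F n) 2 P) ∧ Tendsto (fun n => eLpNorm (F n) 2 P) atTop (𝓝 0)

/-- Minkowski's inequality bounds the norm by a finite sum of null sequences. Measurability of `F`
is a separate hypothesis, as domination does not provide it. -/
lemma IsL2Null.of_le_sum {Ω ι : Type*} [MeasurableSpace Ω] {P : Measure Ω} {s : Finset ι}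
    {F : ℕ → Ω → ℝ≥0∞} {G : ι → ℕ → Ω → ℝ≥0∞} (hG : ∀ i ∈ s, IsL2Null (G i) P)
    (hF : ∀ n, 1 ≤ n → AEMeasurable (F n) P)
    (hle : ∀ n, 1 ≤ n → ∀ᵐ ω ∂P, F n ω ≤ ∑ i ∈ s, G i n ω) : IsL2Null F P := by
  have hb : ∀ n, 1 ≤ n → eLpNorm (F n) 2 P ≤ ∑ i ∈ s, eLpNorm (G i n) 2 P := fun n hn => by
    refine le_trans (eLpNorm_mono_enorm_ae (g := ∑ i ∈ s, G i n) ?_)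
      (eLpNorm_sum_le (fun i hi => ((hG i hi).1 n hn).1) one_le_two)
    filter_upwards [hle n hn] with ω hω
    simpa using hω
  refine ⟨fun n hn => ⟨(hF n hn).aestronglyMeasurable, (hb n hn).trans_lt ?_⟩, ?_⟩
  · exact ENNReal.sum_lt_top.2 fun i hi => ((hG i hi).1 n hn).2
  · have hlim : Tendsto (fun n => ∑ i ∈ s, eLpNorm (G i n) 2 P) atTop (𝓝 0) := by
      simpa using tendsto_finsetSum s fun i hi => (hG i hi).2
    refine tendsto_of_tendsto_of_tendsto_of_le_of_le' tendsto_const_nhds hlim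
      (Eventually.of_forall fun _ => zero_le) ?_
    filter_upwards [eventually_ge_atTop 1] with n hn using hb n hn

lemma IsL2Null.of_lintegral_sq_le {Ω : Type*} [MeasurableSpace Ω] {P : Measure Ω}
    {F : ℕ → Ω → ℝ≥0∞} {b : ℕ → ℝ≥0∞} (hF : ∀ n, 1 ≤ n → AEMeasurable (F n) P)
    (hb : ∀ n, 1 ≤ n → b n < ∞) (hb0 : Tendsto b atTop (𝓝 0))
    (hle : ∀ n, 1 ≤ n → ∫⁻ ω, F n ω ^ 2 ∂P ≤ b n) : IsL2Null F P := by
  have he : ∀ n, 1 ≤ n → eLpNorm (F n) 2 P ≤ b n ^ (1 / 2 : ℝ) := fun n hn => by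
    rw [eLpNorm_eq_lintegral_rpow_enorm_toReal (by simp) (by simp)]
    simp only [enorm_eq_self, ENNReal.toReal_ofNat, ENNReal.rpow_ofNat]
    exact ENNReal.rpow_le_rpow (hle n hn) (by norm_num)
  refine ⟨fun n hn => ⟨(hF n hn).aestronglyMeasurable, (he n hn).trans_lt ?_⟩, ?_⟩
  · exact ENNReal.rpow_lt_top_of_nonneg (by norm_num) (hb n hn).ne
  · have hlim : Tendsto (fun n => b n ^ (1 / 2 : ℝ)) atTop (𝓝 0) := by
      have := (ENNReal.continuous_rpow_const (y := 1 / 2)).tendsto 0 |>.comp hb0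
      simpa [ENNReal.zero_rpow_of_pos, Function.comp_def] using this
    refine tendsto_of_tendsto_of_tendsto_of_le_of_le' tendsto_const_nhds hlim
      (Eventually.of_forall fun _ => zero_le) ?_
    filter_upwards [eventually_ge_atTop 1] with n hn using he n hn

/-! ### Uniform deviation of a single marked integral -/

section Deviation

variable {K : Set ℝ}

/-- The deviation at time `t` of `n⁻¹` times the marked integral with intensity parameter `n c`
against `ρ` from its deterministic limit. -/
noncomputable def markedDeviation (g : K → ℝ) (c κ τ : ℝ) (ν : Measure K) (n : ℕ)
    (ρ : Measure (MarkedSpace K)) (t : ℝ) : ℝ :=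
  (n : ℝ)⁻¹ * ∫ p in timeStrip K t, markedIntegrand g (n * c) κ τ p ∂ρ -
    (∫ y, g y ∂ν) * ∫ s in (0 : ℝ)..t, samuelsonIntensity c κ τ s

/-- The supremum over `[0, T]` of the absolute deviation of the marked integral. -/
noncomputable def markedSup (g : K → ℝ) (c κ τ T : ℝ) (ν : Measure K) (n : ℕ)
    (ρ : Measure (MarkedSpace K)) : ℝ≥0∞ :=
  ⨆ t ∈ Set.Icc (0 : ℝ) T, ‖markedDeviation g c κ τ ν n ρ t‖ₑ

variable {ν : Measure K} {g : K → ℝ} {c κ : ℝ}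

lemma continuousWithinAt_markedDeviation {ρ : Measure (MarkedSpace K)} (hc : 0 ≤ c) (hκ : 0 ≤ κ)
    (τ : ℝ) (n : ℕ) {T : ℝ}
    (h : IntegrableOn (markedIntegrand g (n * c) κ τ) (timeStrip K T) ρ) {t : ℝ} (ht : t < T) :
    ContinuousWithinAt (fun t => markedDeviation g c κ τ ν n ρ t) (Set.Ioi t) t := by
  have hx : Continuous fun t => ∫ s in (0 : ℝ)..t, samuelsonIntensity c κ τ s :=
    intervalIntegral.continuous_primitive
      (fun a b => intervalIntegrable_samuelsonIntensity hc hκ τ a b) 0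
  exact ((continuousWithinAt_setIntegral_timeStrip h ht).const_mul _).sub
    (hx.const_mul _).continuousWithinAt

/-- The pathwise form of the grid comparison. Nonnegativity of `g` makes both functions monotone,
and the intensity is at most `c`, so the limit has Lipschitz constant `c ∫ g dν`. -/
lemma markedSup_sq_le_grid {ρ : Measure (MarkedSpace K)} (hg0 : 0 ≤ g) (hc : 0 ≤ c) (hκ : 0 ≤ κ)
    (τ : ℝ) (n : ℕ) {T : ℝ} (hT : 0 < T)
    (h : IntegrableOn (markedIntegrand g (n * c) κ τ) (timeStrip K T) ρ) {k : ℕ} (hk : 0 < k) :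
    markedSup g c κ τ T ν n ρ ^ 2 ≤
      2 * ∑ i ∈ Finset.range (k + 1), ‖markedDeviation g c κ τ ν n ρ (i * T / k)‖ₑ ^ 2 +
        ENNReal.ofReal (2 * ((∫ y, g y ∂ν) * c * T / k) ^ 2) := by
  have hG : 0 ≤ ∫ y, g y ∂ν := integral_nonneg hg0
  have hΛ : ∀ s t : ℝ, (∫ r in (0 : ℝ)..t, samuelsonIntensity c κ τ r) -
      ∫ r in (0 : ℝ)..s, samuelsonIntensity c κ τ r = ∫ r in s..t, samuelsonIntensity c κ τ r :=
    fun s t => intervalIntegral.integral_interval_sub_left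
      (intervalIntegrable_samuelsonIntensity hc hκ τ 0 t)
      (intervalIntegrable_samuelsonIntensity hc hκ τ 0 s)
  have hX : MonotoneOn (fun t => (n : ℝ)⁻¹ *
      ∫ p in timeStrip K t, markedIntegrand g (n * c) κ τ p ∂ρ) (Set.Icc 0 T) := by
    intro s _ t ht hst
    refine mul_le_mul_of_nonneg_left (setIntegral_mono_set (h.mono_set (timeStrip_mono ht.2))
      (ae_of_all _ (markedIntegrand_nonneg hg0 (n * c) κ τ))
      (timeStrip_mono hst).eventuallyLE) (by positivity)
  have hx : MonotoneOn (fun t => (∫ y, g y ∂ν) *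
      ∫ s in (0 : ℝ)..t, samuelsonIntensity c κ τ s) (Set.Icc 0 T) := by
    intro s _ t _ hst
    refine mul_le_mul_of_nonneg_left ?_ hG
    have := integral_samuelsonIntensity_nonneg hc κ τ hst
    linarith [hΛ s t]
  have hL : ∀ s ∈ Set.Icc 0 T, ∀ t ∈ Set.Icc 0 T, s ≤ t →
      (∫ y, g y ∂ν) * (∫ r in (0 : ℝ)..t, samuelsonIntensity c κ τ r) -
        (∫ y, g y ∂ν) * (∫ r in (0 : ℝ)..s, samuelsonIntensity c κ τ r) ≤
          (∫ y, g y ∂ν) * c * (t - s) := by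
    intro s _ t _ hst
    rw [← mul_sub, hΛ, mul_assoc]
    exact mul_le_mul_of_nonneg_left (integral_samuelsonIntensity_le hc hκ τ hst) hG
  have hsq : ∀ x : ℝ, ‖x‖ₑ ^ 2 = ENNReal.ofReal (x ^ 2) := fun x => by
    rw [← ofReal_norm, ← ENNReal.ofReal_pow (norm_nonneg _), Real.norm_eq_abs, sq_abs]
  simp_rw [markedSup, ENNReal.iSup_pow_of_ne_zero two_ne_zero, hsq]
  refine iSup₂_le fun t ht => ?_
  rw [← ENNReal.ofReal_sum_of_nonneg fun _ _ => sq_nonneg _, ← ENNReal.ofReal_ofNat 2,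
    ← ENNReal.ofReal_mul zero_le_two, ← ENNReal.ofReal_add
      (mul_nonneg zero_le_two (Finset.sum_nonneg fun _ _ => sq_nonneg _)) (by positivity)]
  exact ENNReal.ofReal_le_ofReal (sub_sq_le_grid hT hX hx hL hk ht)

variable {Ω : Type*} [MeasurableSpace Ω] {P : Measure Ω} [IsProbabilityMeasure P]
  [IsFiniteMeasure ν] {N : Ω → Measure (MarkedSpace K)}

lemma ae_integrableOn_markedIntegrand (hN : IsPoissonRandomMeasure N (markedIntensity ν) P)
    (hg : Measurable g) (hgi : Integrable g ν) (hc : 0 ≤ c) (hκ : 0 ≤ κ) (τ : ℝ) {T : ℝ}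
    (hT : 0 ≤ T) : ∀ᵐ ω ∂P, IntegrableOn (markedIntegrand g c κ τ) (timeStrip K T) (N ω) := by
  have hS := measurableSet_timeStrip (K := K) T
  have h := hN.ae_integrable ((measurable_markedIntegrand hg c κ τ).indicator hS)
    ((integrable_indicator_iff hS).2 (integrableOn_markedIntegrand ν hg hgi hc hκ τ hT))
  filter_upwards [h] with ω hω using (integrable_indicator_iff hS).1 hω

lemma aemeasurable_markedDeviation (hN : IsPoissonRandomMeasure N (markedIntensity ν) P)
    (hg : Measurable g) (hgi : Integrable g ν) (hc : 0 ≤ c) (hκ : 0 ≤ κ) (τ : ℝ) (n : ℕ) {t : ℝ}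
    (ht : 0 ≤ t) : AEMeasurable (fun ω => markedDeviation g c κ τ ν n (N ω) t) P := by
  have hS := measurableSet_timeStrip (K := K) t
  have h := hN.aemeasurable_integral ((measurable_markedIntegrand hg (n * c) κ τ).indicator hS)
    ((integrable_indicator_iff hS).2 (integrableOn_markedIntegrand ν hg hgi (by positivity) hκ τ ht))
  simp_rw [integral_indicator hS] at h
  exact (h.const_mul _).sub_const _

lemma aemeasurable_markedSup (hN : IsPoissonRandomMeasure N (markedIntensity ν) P)
    (hg : Measurable g) (hgi : Integrable g ν) (hc : 0 ≤ c) (hκ : 0 ≤ κ) (τ : ℝ) (n : ℕ) {T : ℝ}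
    (hT : 0 ≤ T) : AEMeasurable (fun ω => markedSup g c κ τ T ν n (N ω)) P := by
  refine AEMeasurable.congr (AEMeasurable.biSup
    ((Set.range ((↑) : ℚ → ℝ) ∪ {T}) ∩ Set.Icc 0 T)
    (((Set.countable_range _).union (Set.countable_singleton T)).mono Set.inter_subset_left)
    (f := fun t ω => ‖markedDeviation g c κ τ ν n (N ω) t‖ₑ) fun t ht =>
      (aemeasurable_markedDeviation hN hg hgi hc hκ τ n ht.2.1).enorm) ?_
  filter_upwards [ae_integrableOn_markedIntegrand hN hg hgi (by positivity : 0 ≤ n * c) hκ τ hT]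
    with ω hω
  exact (iSup_Icc_eq_iSup_rat fun t ht =>
    (continuousWithinAt_markedDeviation hc hκ τ n hω ht.2).enorm).symm

/-- The intensity is linear in its parameter, so the unscaled integral has variance `n ∫ g² dν · Λ`.
The factor `n⁻²` leaves `1/n`, and `Λ ≤ c t`. -/
lemma lintegral_enorm_markedDeviation_sq_le
    (hN : IsPoissonRandomMeasure N (markedIntensity ν) P) (hg : Measurable g)
    (hgi : Integrable g ν) (hg2 : Integrable (fun y => g y ^ 2) ν) (hg0 : 0 ≤ g) (hc : 0 ≤ c)
    (hκ : 0 ≤ κ) (τ : ℝ) {n : ℕ} (hn : 1 ≤ n) {t : ℝ} (ht : 0 ≤ t) :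
    ∫⁻ ω, ‖markedDeviation g c κ τ ν n (N ω) t‖ₑ ^ 2 ∂P ≤
      ENNReal.ofReal ((∫ y, g y ^ 2 ∂ν) * (c * t) / n) := by
  have hn' : (0 : ℝ) < n := by exact_mod_cast hn
  have hnc : 0 ≤ n * c := by positivity
  have hS := measurableSet_timeStrip (K := K) t
  set Λ : ℝ := ∫ s in (0 : ℝ)..t, samuelsonIntensity c κ τ s with hΛ
  have hΛn : ∫ s in (0 : ℝ)..t, samuelsonIntensity (n * c) κ τ s = n * Λ := by
    simp_rw [samuelsonIntensity_mul, intervalIntegral.integral_const_mul, hΛ]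
  have hvar := hN.lintegral_enorm_integral_sub_sq
    ((measurable_markedIntegrand hg (n * c) κ τ).indicator hS)
    (Set.indicator_nonneg fun p _ => markedIntegrand_nonneg hg0 (n * c) κ τ p)
    ((integrable_indicator_iff hS).2 (integrableOn_markedIntegrand ν hg hgi hnc hκ τ ht))
  have hind : ∀ p, ENNReal.ofReal ((timeStrip K t).indicator (markedIntegrand g (n * c) κ τ) p) ^ 2
      = (timeStrip K t).indicator
        (fun p => ENNReal.ofReal (markedIntegrand g (n * c) κ τ p) ^ 2) p := fun p => by
    by_cases hp : p ∈ timeStrip K t <;> simp [hp]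
  simp_rw [hind] at hvar
  rw [lintegral_indicator hS, lintegral_markedIntegrand_sq ν hg hg2 hg0 hnc hκ τ ht, hΛn] at hvar
  simp_rw [integral_indicator hS] at hvar
  rw [integral_markedIntegrand ν hg hg0 hnc hκ τ ht, hΛn] at hvar
  have hdev : ∀ ω, ‖markedDeviation g c κ τ ν n (N ω) t‖ₑ ^ 2 = ENNReal.ofReal ((n : ℝ)⁻¹ ^ 2) *
      ‖∫ p in timeStrip K t, markedIntegrand g (n * c) κ τ p ∂(N ω) -
        (∫ y, g y ∂ν) * (n * Λ)‖ₑ ^ 2 := fun ω => by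
    rw [ENNReal.ofReal_pow (by positivity), ← Real.enorm_of_nonneg (by positivity : 0 ≤ (n : ℝ)⁻¹),
      ← mul_pow, ← enorm_mul]
    congr 2
    rw [markedDeviation, ← hΛ]
    field_simp
  simp_rw [hdev]
  rw [lintegral_const_mul' _ _ ENNReal.ofReal_ne_top, hvar, ← ENNReal.ofReal_mul (by positivity)]
  refine ENNReal.ofReal_le_ofReal ?_
  have hle : Λ ≤ c * t := by
    simpa using integral_samuelsonIntensity_le hc hκ τ ht
  have hV : 0 ≤ ∫ y, g y ^ 2 ∂ν := integral_nonneg fun y => sq_nonneg _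
  calc (n : ℝ)⁻¹ ^ 2 * ((∫ y, g y ^ 2 ∂ν) * (n * Λ)) = (∫ y, g y ^ 2 ∂ν) * Λ / n := by
        field_simp
    _ ≤ _ := by gcongr

/-- The number of cells `k` stays free: refining the grid lowers the Lipschitz error but adds one
variance term per grid point. -/
lemma lintegral_markedSup_sq_le
    (hN : IsPoissonRandomMeasure N (markedIntensity ν) P) (hg : Measurable g)
    (hgi : Integrable g ν) (hg2 : Integrable (fun y => g y ^ 2) ν) (hg0 : 0 ≤ g) (hc : 0 ≤ c)
    (hκ : 0 ≤ κ) (τ : ℝ) {n : ℕ} (hn : 1 ≤ n) {T : ℝ} (hT : 0 < T) {k : ℕ} (hk : 0 < k) :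
    ∫⁻ ω, markedSup g c κ τ T ν n (N ω) ^ 2 ∂P ≤
      ENNReal.ofReal (2 * ((k + 1) * ((∫ y, g y ^ 2 ∂ν) * (c * T) / n)) +
        2 * ((∫ y, g y ∂ν) * c * T / k) ^ 2) := by
  have hk' : (0 : ℝ) < k := by exact_mod_cast hk
  have hV : 0 ≤ ∫ y, g y ^ 2 ∂ν := integral_nonneg fun y => sq_nonneg _
  have hm : ∀ i ∈ Finset.range (k + 1), AEMeasurable
      (fun ω => ‖markedDeviation g c κ τ ν n (N ω) (i * T / k)‖ₑ ^ 2) P := fun i _ =>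
    (aemeasurable_markedDeviation hN hg hgi hc hκ τ n (by positivity)).enorm.pow_const 2
  have hle : ∀ᵐ ω ∂P, markedSup g c κ τ T ν n (N ω) ^ 2 ≤
      2 * ∑ i ∈ Finset.range (k + 1), ‖markedDeviation g c κ τ ν n (N ω) (i * T / k)‖ₑ ^ 2 +
        ENNReal.ofReal (2 * ((∫ y, g y ∂ν) * c * T / k) ^ 2) := by
    filter_upwards [ae_integrableOn_markedIntegrand hN hg hgi (by positivity : 0 ≤ n * c) hκ τ
      hT.le] with ω hω using markedSup_sq_le_grid hg0 hc hκ τ n hT hω hk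
  refine (lintegral_mono_ae hle).trans ?_
  rw [lintegral_add_right _ measurable_const, lintegral_const_mul' _ _ (by simp),
    lintegral_finsetSum' _ hm, lintegral_const, measure_univ, mul_one,
    ENNReal.ofReal_add (by positivity) (by positivity), ENNReal.ofReal_mul zero_le_two
      (q := (k + 1) * ((∫ y, g y ^ 2 ∂ν) * (c * T) / n)), ENNReal.ofReal_ofNat]
  refine add_le_add (mul_le_mul' le_rfl ?_) le_rfl
  calc ∑ i ∈ Finset.range (k + 1), ∫⁻ ω, ‖markedDeviation g c κ τ ν n (N ω) (i * T / k)‖ₑ ^ 2 ∂P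
      ≤ ∑ i ∈ Finset.range (k + 1), ENNReal.ofReal ((∫ y, g y ^ 2 ∂ν) * (c * T) / n) := by
        refine Finset.sum_le_sum fun i hi => ?_
        refine (lintegral_enorm_markedDeviation_sq_le hN hg hgi hg2 hg0 hc hκ τ hn
          (by positivity)).trans (ENNReal.ofReal_le_ofReal ?_)
        have hi' : (i : ℝ) ≤ k := by exact_mod_cast Nat.lt_succ_iff.1 (Finset.mem_range.1 hi)
        have : i * T / k ≤ T := by
          rw [div_le_iff₀ hk', mul_comm]
          exact mul_le_mul_of_nonneg_left hi' hT.le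
        gcongr
    _ = _ := by
        rw [Finset.sum_const, Finset.card_range, nsmul_eq_mul,
          ENNReal.ofReal_mul (by positivity)]
        congr 1
        rw [← Nat.cast_succ, ENNReal.ofReal_natCast]

lemma isL2Null_markedSup_of_nonneg
    (hN : IsPoissonRandomMeasure N (markedIntensity ν) P) (hg : Measurable g)
    (hgi : Integrable g ν) (hg2 : Integrable (fun y => g y ^ 2) ν) (hg0 : 0 ≤ g) (hc : 0 ≤ c)
    (hκ : 0 ≤ κ) (τ : ℝ) {T : ℝ} (hT : 0 < T) :
    IsL2Null (fun n ω => markedSup g c κ τ T ν n (N ω)) P := by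
  set V : ℝ := (∫ y, g y ^ 2 ∂ν) * (c * T) with hVdef
  set D : ℝ := (∫ y, g y ∂ν) * c * T with hDdef
  have hV : 0 ≤ V := mul_nonneg (integral_nonneg fun y => sq_nonneg _) (by positivity)
  refine IsL2Null.of_lintegral_sq_le
    -- With `k = Nat.sqrt n`, the bounds `k + 1 ≤ 2k` and `k² ≤ n` give `4V/k` for the variance
    -- terms, and `k ≥ 1` gives `2D²/k` for the Lipschitz error.
    (b := fun n => ENNReal.ofReal ((4 * V + 2 * D ^ 2) / (Nat.sqrt n : ℝ)))
    (fun n _ => aemeasurable_markedSup hN hg hgi hc hκ τ n hT.le)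
    (fun n _ => ENNReal.ofReal_lt_top) ?_ fun n hn => ?_
  · have hs : Tendsto (fun n : ℕ => (Nat.sqrt n : ℝ)) atTop atTop :=
      tendsto_natCast_atTop_atTop.comp
        (tendsto_atTop_mono' (f₁ := fun n => Nat.sqrt n) atTop (Eventually.of_forall fun _ => le_rfl)
          (tendsto_atTop_atTop.2 fun b => ⟨b * b, fun a ha => Nat.le_sqrt.2 ha⟩))
    simpa using ENNReal.tendsto_ofReal (hs.const_div_atTop (4 * V + 2 * D ^ 2))
  · have hk : 0 < Nat.sqrt n := Nat.sqrt_pos.2 hn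
    refine (lintegral_markedSup_sq_le hN hg hgi hg2 hg0 hc hκ τ hn hT hk).trans
      (ENNReal.ofReal_le_ofReal ?_)
    have hk1 : (1 : ℝ) ≤ Nat.sqrt n := by exact_mod_cast hk
    have hkn : (Nat.sqrt n : ℝ) * Nat.sqrt n ≤ n := by exact_mod_cast Nat.sqrt_le n
    rw [← hVdef, ← hDdef]
    generalize (Nat.sqrt n : ℝ) = k at *
    have hk0 : 0 < k := by linarith
    have h1 : (k + 1) * (V / n) ≤ 2 * V / k := by
      calc (k + 1) * (V / n) ≤ (2 * k) * (V / (k * k)) := by gcongr; linarith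
        _ = 2 * V / k := by field_simp
    have h2 : (D / k) ^ 2 ≤ D ^ 2 / k := by
      rw [div_pow]
      exact div_le_div_of_nonneg_left (sq_nonneg D) hk0 (by nlinarith)
    calc 2 * ((k + 1) * (V / n)) + 2 * (D / k) ^ 2 ≤ 2 * (2 * V / k) + 2 * (D ^ 2 / k) := by gcongr
      _ = (4 * V + 2 * D ^ 2) / k := by ring

/-- For signed `g` the paths are no longer monotone. The deviation is linear in `g` wherever both
parts are integrable, so the positive and negative parts are handled separately; both are dominated
by `|g|` and remain square integrable. -/
lemma isL2Null_markedSup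
    (hN : IsPoissonRandomMeasure N (markedIntensity ν) P) (hg : Measurable g)
    (hg2 : Integrable (fun y => g y ^ 2) ν) (hc : 0 ≤ c)
    (hκ : 0 ≤ κ) (τ : ℝ) {T : ℝ} (hT : 0 < T) :
    IsL2Null (fun n ω => markedSup g c κ τ T ν n (N ω)) P := by
  have hL2 : MemLp g 2 ν := (memLp_two_iff_integrable_sq hg.aestronglyMeasurable).2 hg2
  have hgi : Integrable g ν := hL2.integrable one_le_two
  have hp : Measurable fun y => max (g y) 0 := hg.max measurable_const
  have hm : Measurable fun y => max (-g y) 0 := hg.neg.max measurable_const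
  have hpi : Integrable (fun y => max (g y) 0) ν := hgi.pos_part
  have hmi : Integrable (fun y => max (-g y) 0) ν := hgi.neg_part
  have hsq : ∀ {f : K → ℝ}, Measurable f → (∀ y, |f y| ≤ |g y|) →
      Integrable (fun y => f y ^ 2) ν := fun {f} hf hfg =>
    hg2.mono' (hf.pow_const 2).aestronglyMeasurable (ae_of_all _ fun y => by
      rw [Real.norm_of_nonneg (sq_nonneg _)]
      exact sq_le_sq.2 (hfg y))
  have hp2 := hsq hp fun y => by
    rw [abs_of_nonneg (le_max_right _ _)]
    exact max_le (le_abs_self _) (abs_nonneg _)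
  have hm2 := hsq hm fun y => by
    rw [abs_of_nonneg (le_max_right _ _)]
    exact max_le (neg_le_abs _) (abs_nonneg _)
  have hp0 : 0 ≤ fun y => max (g y) 0 := fun y => le_max_right _ _
  have hm0 : 0 ≤ fun y => max (-g y) 0 := fun y => le_max_right _ _
  have hdec : ∀ y, g y = max (g y) 0 - max (-g y) 0 := fun y => by
    rw [max_zero_sub_max_neg_zero_eq_self]
  refine IsL2Null.of_le_sum (s := Finset.univ) (G := fun (b : Bool) n ω =>
    if b then markedSup (fun y => max (g y) 0) c κ τ T ν n (N ω)
      else markedSup (fun y => max (-g y) 0) c κ τ T ν n (N ω)) ?_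
    (fun n _ => aemeasurable_markedSup hN hg hgi hc hκ τ n hT.le) fun n _ => ?_
  · rintro (_ | _) -
    · simpa using isL2Null_markedSup_of_nonneg hN hm hmi hm2 hm0 hc hκ τ hT
    · simpa using isL2Null_markedSup_of_nonneg hN hp hpi hp2 hp0 hc hκ τ hT
  · have hnc : 0 ≤ n * c := by positivity
    filter_upwards [ae_integrableOn_markedIntegrand hN hp hpi hnc hκ τ hT.le,
      ae_integrableOn_markedIntegrand hN hm hmi hnc hκ τ hT.le] with ω hωp hωm
    simp only [Fintype.sum_bool, if_true, Bool.false_eq_true, if_false]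
    refine iSup₂_le fun t ht => ?_
    have hsub := timeStrip_mono (K := K) ht.2
    have hint : ∫ p in timeStrip K t, markedIntegrand g (n * c) κ τ p ∂(N ω) =
        (∫ p in timeStrip K t, markedIntegrand (fun y => max (g y) 0) (n * c) κ τ p ∂(N ω)) -
        ∫ p in timeStrip K t, markedIntegrand (fun y => max (-g y) 0) (n * c) κ τ p ∂(N ω) := by
      rw [← integral_sub (hωp.mono_set hsub) (hωm.mono_set hsub)]
      refine integral_congr_ae (ae_of_all _ fun p => ?_)
      simp only [markedIntegrand]
      rw [← sub_mul, ← hdec]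
    have hmean : ∫ y, g y ∂ν = (∫ y, max (g y) 0 ∂ν) - ∫ y, max (-g y) 0 ∂ν := by
      rw [← integral_sub hpi hmi]
      exact integral_congr_ae (ae_of_all _ hdec)
    have hdev : markedDeviation g c κ τ ν n (N ω) t =
        markedDeviation (fun y => max (g y) 0) c κ τ ν n (N ω) t -
          markedDeviation (fun y => max (-g y) 0) c κ τ ν n (N ω) t := by
      simp only [markedDeviation]
      rw [hint, hmean]
      ring
    rw [hdev]
    refine enorm_sub_le.trans (add_le_add ?_ ?_)
    · exact le_iSup₂_of_le (f := fun t _ =>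
        ‖markedDeviation (fun y => max (g y) 0) c κ τ ν n (N ω) t‖ₑ) t ht le_rfl
    · exact le_iSup₂_of_le (f := fun t _ =>
        ‖markedDeviation (fun y => max (-g y) 0) c κ τ ν n (N ω) t‖ₑ) t ht le_rfl

end Deviation

/-! ### From single integrals to the vector of maturities -/

lemma EuclideanSpace.enorm_le_sum {ι : Type*} [Fintype ι] (v : EuclideanSpace ℝ ι) :
    ‖v‖ₑ ≤ ∑ i, ‖v i‖ₑ := by
  have h : ‖v‖ ≤ ∑ i, ‖v i‖ := by
    rw [EuclideanSpace.norm_eq]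
    exact Real.sqrt_le_iff.2 ⟨Finset.sum_nonneg fun _ _ => norm_nonneg _,
      Finset.sum_sq_le_sq_sum_of_nonneg fun _ _ => norm_nonneg _⟩
  simp_rw [← ofReal_norm]
  rw [← ENNReal.ofReal_sum_of_nonneg fun _ _ => norm_nonneg _]
  exact ENNReal.ofReal_le_ofReal h

section Vector

variable {K : Set ℝ} {M : ℕ}

lemma smul_markedIntegrals_sub_markedLimit (τ : Fin M → ℝ) (g : K → ℝ) {c c' κ : ℝ} (hc : 0 ≤ c)
    (hc' : 0 ≤ c') (hκ : 0 ≤ κ) (ν : Measure K) (π : Option (Fin M) → Measure (MarkedSpace K))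
    (n : ℕ) (t : ℝ) :
    (n : ℝ)⁻¹ • markedIntegrals τ g (n * c) (n * c') κ π t - markedLimit τ g c c' κ ν t =
      WithLp.toLp 2 fun m => markedDeviation g c κ (τ m) ν n (π (some m)) t +
        markedDeviation g c' κ (τ m) ν n (π none) t := by
  ext m
  simp only [markedIntegrals, markedLimit, markedDeviation, PiLp.sub_apply, PiLp.smul_apply,
    smul_eq_mul]
  simp_rw [samuelsonIntensity_add]
  rw [intervalIntegral.integral_add (intervalIntegrable_samuelsonIntensity hc hκ _ _ _)
    (intervalIntegrable_samuelsonIntensity hc' hκ _ _ _)]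
  ring

lemma uniformError_le_sum_markedSup (τ : Fin M → ℝ) (T : ℝ) (g : K → ℝ) {c c' κ : ℝ} (hc : 0 ≤ c)
    (hc' : 0 ≤ c') (hκ : 0 ≤ κ) (ν : Measure K) (π : Option (Fin M) → Measure (MarkedSpace K))
    (n : ℕ) :
    uniformError τ T g c c' κ ν π n ≤ ∑ m, (markedSup g c κ (τ m) T ν n (π (some m)) +
      markedSup g c' κ (τ m) T ν n (π none)) := by
  refine iSup₂_le fun t ht => ?_
  rw [smul_markedIntegrals_sub_markedLimit τ g hc hc' hκ]
  refine (EuclideanSpace.enorm_le_sum _).trans (Finset.sum_le_sum fun m _ => ?_)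
  refine (enorm_add_le _ _).trans (add_le_add ?_ ?_)
  · exact le_iSup₂_of_le (f := fun t _ => ‖markedDeviation g c κ (τ m) ν n (π (some m)) t‖ₑ) t ht
      le_rfl
  · exact le_iSup₂_of_le (f := fun t _ => ‖markedDeviation g c' κ (τ m) ν n (π none) t‖ₑ) t ht
      le_rfl

variable {Ω : Type*} [MeasurableSpace Ω] {P : Measure Ω} [IsProbabilityMeasure P]
  {ν : Measure K} [IsFiniteMeasure ν] {π : Option (Fin M) → Ω → Measure (MarkedSpace K)}

/-- The norm of the vector mixes all coordinates, so its supremum is not a function of the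
coordinatewise suprema; the reduction to a countable set of times is repeated for the vector path.
-/
lemma aemeasurable_uniformError
    (hπ : ∀ i, IsPoissonRandomMeasure (π i) (markedIntensity ν) P) (τ : Fin M → ℝ) {T : ℝ}
    (hT : 0 ≤ T) {g : K → ℝ} (hg : Measurable g) (hgi : Integrable g ν) {c c' κ : ℝ} (hc : 0 ≤ c)
    (hc' : 0 ≤ c') (hκ : 0 ≤ κ) (n : ℕ) :
    AEMeasurable (fun ω => uniformError τ T g c c' κ ν (fun i => π i ω) n) P := by
  simp_rw [uniformError, smul_markedIntegrals_sub_markedLimit τ g hc hc' hκ]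
  refine AEMeasurable.congr (AEMeasurable.biSup
    ((Set.range ((↑) : ℚ → ℝ) ∪ {T}) ∩ Set.Icc 0 T)
    (((Set.countable_range _).union (Set.countable_singleton T)).mono Set.inter_subset_left)
    (f := fun t ω => ‖(WithLp.toLp 2 fun m => markedDeviation g c κ (τ m) ν n (π (some m) ω) t +
        markedDeviation g c' κ (τ m) ν n (π none ω) t : EuclideanSpace ℝ (Fin M))‖ₑ)
    fun t ht => ?_) ?_
  · refine AEMeasurable.enorm ?_
    refine (WithLp.measurable_toLp 2 _).comp_aemeasurable (aemeasurable_pi_lambda _ fun m => ?_)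
    exact (aemeasurable_markedDeviation (hπ (some m)) hg hgi hc hκ (τ m) n ht.2.1).add
      (aemeasurable_markedDeviation (hπ none) hg hgi hc' hκ (τ m) n ht.2.1)
  · have h : ∀ m, ∀ᵐ ω ∂P,
        IntegrableOn (markedIntegrand g (n * c) κ (τ m)) (timeStrip K T) (π (some m) ω) ∧
        IntegrableOn (markedIntegrand g (n * c') κ (τ m)) (timeStrip K T) (π none ω) := fun m =>
      (ae_integrableOn_markedIntegrand (hπ (some m)) hg hgi (by positivity) hκ (τ m) hT).and
        (ae_integrableOn_markedIntegrand (hπ none) hg hgi (by positivity) hκ (τ m) hT)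
    filter_upwards [ae_all_iff.2 h] with ω hω
    refine (iSup_Icc_eq_iSup_rat fun t ht => ?_).symm
    refine ContinuousWithinAt.enorm ?_
    refine (PiLp.continuous_toLp 2 _).continuousAt.comp_continuousWithinAt
      (continuousWithinAt_pi.2 fun m => ?_)
    exact (continuousWithinAt_markedDeviation hc hκ (τ m) n (hω m).1 ht.2).add
      (continuousWithinAt_markedDeviation hc' hκ (τ m) n (hω m).2 ht.2)

lemma isL2Null_uniformError
    (hπ : ∀ i, IsPoissonRandomMeasure (π i) (markedIntensity ν) P) (τ : Fin M → ℝ) {T : ℝ}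
    (hT : 0 < T) {g : K → ℝ} (hg : Measurable g) (hg2 : Integrable (fun y => g y ^ 2) ν)
    {c c' κ : ℝ} (hc : 0 ≤ c) (hc' : 0 ≤ c') (hκ : 0 ≤ κ) :
    IsL2Null (fun n ω => uniformError τ T g c c' κ ν (fun i => π i ω) n) P := by
  have hgi : Integrable g ν :=
    ((memLp_two_iff_integrable_sq hg.aestronglyMeasurable).2 hg2).integrable one_le_two
  have hmeas : ∀ n, AEMeasurable (fun ω => uniformError τ T g c c' κ ν (fun i => π i ω) n) P :=
    fun n => aemeasurable_uniformError hπ τ hT.le hg hgi hc hc' hκ n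
  -- One summand per maturity and per type of shock. The common measure appears in every coordinate,
  -- which is harmless since only the triangle inequality is used.
  refine IsL2Null.of_le_sum (s := Finset.univ) (G := fun (j : Fin M ⊕ Fin M) n ω =>
    j.elim (fun m => markedSup g c κ (τ m) T ν n (π (some m) ω))
      (fun m => markedSup g c' κ (τ m) T ν n (π none ω))) ?_ (fun n _ => hmeas n)
    fun n _ => ae_of_all _ fun ω => ?_
  · rintro (m | m) -
    · exact isL2Null_markedSup (hπ (some m)) hg hg2 hc hκ (τ m) hT
    · exact isL2Null_markedSup (hπ none) hg hg2 hc' hκ (τ m) hT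
  · refine (uniformError_le_sum_markedSup τ T g hc hc' hκ ν (fun i => π i ω) n).trans_eq ?_
    simp [Finset.sum_add_distrib]

end Vector

theorem proposition3 {Ω : Type*} [MeasurableSpace Ω] (P : Measure Ω) [IsProbabilityMeasure P]
    (M : ℕ) (hM : 0 < M) (τ : Fin M → ℝ) (hτpos : ∀ m, 0 < τ m) (hτmono : StrictMono τ)
    (T : ℝ) (hT : τ ⟨M - 1, Nat.sub_one_lt hM.ne'⟩ = T)
    (K : Set ℝ) (hK : K ⊆ Set.Ici 0) (ν : Measure K) [IsProbabilityMeasure ν]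
    (hν0 : ν {y | (y : ℝ) = 0} = 0) (hν2 : Integrable (fun y : K => (y : ℝ) ^ 2) ν)
    (κ μ μc : ℝ) (hκ : 0 ≤ κ) (hμ : 0 < μ) (hμc : 0 < μc)
    (π : PriceSide → Option (Fin M) → Ω → Measure (MarkedSpace K))
    (hπ : ∀ h i, IsPoissonRandomMeasure (π h i) (markedIntensity ν) P)
    (hindep : ProbabilityTheory.iIndepFun (fun (j : PriceSide × Option (Fin M)) ω => π j.1 j.2 ω) P)
    (g : K → ℝ) (hg : Measurable g) (hg2 : Integrable (fun y => g y ^ 2) ν)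
    (h : PriceSide) :
    (∀ n : ℕ, 1 ≤ n → ∀ᵐ ω ∂P, ∀ m : Fin M,
      IntegrableOn (markedIntegrand g (n * μ) κ (τ m)) (timeStrip K T) (π h (some m) ω) ∧
      IntegrableOn (markedIntegrand g (n * μc) κ (τ m)) (timeStrip K T) (π h none ω)) ∧
    (∀ n : ℕ, 1 ≤ n → MemLp (fun ω => uniformError τ T g μ μc κ ν (fun i => π h i ω) n) 2 P) ∧
    Tendsto (fun n : ℕ => eLpNorm (fun ω => uniformError τ T g μ μc κ ν (fun i => π h i ω) n) 2 P)
      atTop (𝓝 0) := by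
  have hT0 : 0 < T := hT ▸ hτpos _
  have hgi : Integrable g ν :=
    ((memLp_two_iff_integrable_sq hg.aestronglyMeasurable).2 hg2).integrable one_le_two
  have hnull := isL2Null_uniformError (hπ h) τ hT0 hg hg2 hμ.le hμc.le hκ
  refine ⟨fun n _ => ae_all_iff.2 fun m => ?_, hnull.1, hnull.2⟩
  exact (ae_integrableOn_markedIntegrand (hπ h (some m)) hg hgi (by positivity) hκ (τ m)
    hT0.le).and
    (ae_integrableOn_markedIntegrand (hπ h none) hg hgi (by positivity) hκ (τ m) hT0.le)
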